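/- Let $(\mathcal Y,\mathscr A)$ be a measurable space (for instance a metric space with its Borel sets), let $\{\mu_\theta:\theta\in\Theta\}$ be a statistical model of probability measures on $\mathcal Y$ depending measurably on $\theta$, let $\pi$ be a prior probability measure on $\Theta$, and let $\mu^*$ be a probability measure on $\mathcal Y$. Let $\mathfrak F$ be a class of measurable functions $f:\mathcal Y\to\mathbb R$ with $\sup_y|f(y)|/g(y)<\infty$ for every $f\in\mathfrak F$, for some measurable $g:\mathcal Y\to[1,\infty)$. Define the integral probability semimetric $$\mathcal D_{\mathfrak F}(\mu,\nu)=\sup_{f\in\mathfrak F}\Bigl|\int f\,d\mu-\int f\,d\nu\Bigr|,$$ put $\varepsilon^*=\inf_{\theta\in\Theta}\mathcal D_{\mathfrak F}(\mu_\theta,\mu^*)$, and write $\hat\mu_{x_{1:n}}=n^{-1}\sum_{i=1}^n\delta_{x_i}$. The uniform Rademacher complexity is $$\mathfrak R_n(\mathfrak F)=\sup_{\mu}\ \mathbb E\Bigl[\sup_{f\in\mathfrak F}\Bigl|\frac1n\sum_{i=1}^n\epsilon_i f(x_i)\Bigr|\Bigr],$$ where the outer supremum is over all probability measures $\mu$ on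 $\mathcal Y$, the $x_i$ are i.i.d. from $\mu$, and the $\epsilon_i$ are i.i.d., uniform on $\{-1,1\}$ and independent of the $x_i$; the inner supremum is assumed to be a measurable function of $x_{1:n}$ for every $n$ and all signs. Given data $y_{1:n}$, the ABC posterior $\pi_n^{(\varepsilon)}$ with threshold $\varepsilon$ is the probability measure on $\Theta$ whose density with respect to $\pi$ is proportional to $\theta\mapsto\mu_\theta^{\otimes n}\bigl(\{z_{1:n}:\mathcal D_{\mathfrak F}(\hat\mu_{z_{1:n}},\hat\mu_{y_{1:n}})\le\varepsilon\}\bigr)$; it is well defined if the $\pi$-integral of this function is positive. Assume: (I) the data $y_1,y_2,\dots$ are i.i.d. from $\mu^*$; (II) there are $L,c_\pi>0$ such that $\pi(\{\theta:\mathcal D_{\mathfrak F}(\mu_\theta,\mu^*)\le\varepsilon^*+\bar\varepsilon\})\ge c_\pi\bar\varepsilon^{\,L}$ for all sufficiently small $\bar\varepsilon>0$; (III) there is $b>0$ with $\|f\|_\infty\le b$ for all $f\in\mathfrak F$; (IV) $\mathfrak R_n(\mathfrak F)\to0$ as $n\to\infty$. Let $\bar\varepsilon_n\to0$ with $n\bar\varepsilon_n^2\to\infty$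 and $\bar\varepsilon_n/\mathfrak R_n(\mathfrak F)\to\infty$ (where $a/0=+\infty$ for $a>0$, and the ratio is read as $0$ when $\bar\varepsilon_n\le0$, so that $\bar\varepsilon_n>0$ for all large $n$). Then, with probability (over the data $y_{1:n}$) tending to $1$ as $n\to\infty$, the ABC posterior with threshold $\varepsilon^*+\bar\varepsilon_n$ is well defined and $$\pi_n^{(\varepsilon^*+\bar\varepsilon_n)}\Bigl(\Bigl\{\theta:\mathcal D_{\mathfrak F}(\mu_\theta,\mu^*)>\varepsilon^*+\frac{4\bar\varepsilon_n}{3}+2\mathfrak R_n(\mathfrak F)+\Bigl[\frac{2b^2}{n}\log\frac{n}{\bar\varepsilon_n^{\,L}}\Bigr]^{1/2}\Bigr\}\Bigr)\le\frac{2\cdot3^L}{c_\pi\,n}.$$ -/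

import Mathlib

open MeasureTheory ProbabilityTheory Filter Topology
open scoped ENNReal

noncomputable section

namespace ABC

/-- `F` is a class of functions that generates an integral probability semimetric: for some
measurable `g : Y → [1, ∞)`, every `f ∈ F` is measurable with `sup_y |f y| / g y < ∞`. -/
def IsIPSClass {Y : Type*} [MeasurableSpace Y] (F : Set (Y → ℝ)) : Prop :=
  ∃ g : Y → ℝ, Measurable g ∧ (∀ y, 1 ≤ g y) ∧
    ∀ f ∈ F, Measurable f ∧ BddAbove (Set.range fun y => |f y| / g y)

/-- The integral probability semimetric `D_F(μ, ν) = sup_{f ∈ F} |∫ f dμ - ∫ f dν|`,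
with values in `[0, ∞]`. -/
def ips {Y : Type*} [MeasurableSpace Y] (F : Set (Y → ℝ)) (μ ν : Measure Y) : ℝ≥0∞ :=
  ⨆ f ∈ F, ENNReal.ofReal |(∫ y, f y ∂μ) - ∫ y, f y ∂ν|

/-- The empirical measure `n⁻¹ ∑ i, δ_{x i}` of a sample `x` of size `n`. -/
def empirical {Y : Type*} [MeasurableSpace Y] {n : ℕ} (x : Fin n → Y) : Measure Y :=
  (n : ℝ≥0∞)⁻¹ • ∑ i, Measure.dirac (x i)

/-- The supremum `sup_{f ∈ F} |(1/n) ∑ i, ε i * f (x i)|`, for signs `ε i ∈ {1, -1}`. -/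
def rademacherSup {Y : Type*} (F : Set (Y → ℝ)) {n : ℕ} (ε : Fin n → ℤˣ) (x : Fin n → Y) :
    ℝ≥0∞ :=
  ⨆ f ∈ F, ENNReal.ofReal |(1 / (n : ℝ)) * ∑ i, ((ε i : ℤ) : ℝ) * f (x i)|

/-- The Rademacher complexity of `F` under `μ`: the expectation of `rademacherSup` over
`x i` i.i.d. from `μ` and independent signs, uniform on `{1, -1}^n`. -/
def rademacherComplexity {Y : Type*} [MeasurableSpace Y] (F : Set (Y → ℝ)) (μ : Measure Y) (n : ℕ) :
    ℝ≥0∞ :=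
  ∫⁻ x : Fin n → Y, ((2 : ℝ≥0∞) ^ n)⁻¹ * ∑ ε : Fin n → ℤˣ, rademacherSup F ε x
    ∂(Measure.pi fun _ => μ)

/-- The uniform Rademacher complexity: the supremum over all probability measures on `Y`. -/
def uniformRademacher {Y : Type*} [MeasurableSpace Y] (F : Set (Y → ℝ)) (n : ℕ) : ℝ≥0∞ :=
  ⨆ μ : ProbabilityMeasure Y, rademacherComplexity F (μ : Measure Y) n

/-- The lowest attainable discrepancy `ε* = inf_θ D_F(μ_θ, μ*)`. -/
def minDiscrepancy {Y Θ : Type*} [MeasurableSpace Y] [MeasurableSpace Θ] (F : Set (Y → ℝ))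
    (model : Kernel Θ Y) (μstar : Measure Y) : ℝ≥0∞ :=
  ⨅ θ, ips F (model θ) μstar

/-- The probability that a synthetic sample `z` of size `n`, i.i.d. from `μ_θ`, satisfies
`D_F(empirical z, empirical y) ≤ ε`. -/
def acceptProb {Y Θ : Type*} [MeasurableSpace Y] [MeasurableSpace Θ] (F : Set (Y → ℝ))
    (model : Kernel Θ Y) {n : ℕ} (y : Fin n → Y) (ε : ℝ≥0∞) (θ : Θ) : ℝ≥0∞ :=
  (Measure.pi fun _ : Fin n => model θ) {z | ips F (empirical z) (empirical y) ≤ ε}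

/-- The ABC posterior with threshold `ε` given the data `y`: the prior reweighted by
`acceptProb` and normalized. It is a probability measure exactly when the overall acceptance
probability is positive, and is the zero measure otherwise. -/
def abcPosterior {Y Θ : Type*} [MeasurableSpace Y] [MeasurableSpace Θ] (F : Set (Y → ℝ))
    (model : Kernel Θ Y) (prior : Measure Θ) {n : ℕ} (y : Fin n → Y) (ε : ℝ≥0∞) : Measure Θ :=
  (prior.withDensity (acceptProb F model y ε) Set.univ)⁻¹ •
    prior.withDensity (acceptProb F model y ε)

/-- The events `E n` hold with `P`-probability tending to one. This is written through the
(outer) measure of the complements, which is the strong reading when `E n` is not known to be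
measurable and the usual one when it is. -/
def WithProbTendingToOne {Ω : Type*} [MeasurableSpace Ω] (P : Measure Ω) (E : ℕ → Set Ω) : Prop :=
  Tendsto (fun n => P (E n)ᶜ) atTop (𝓝 0)

end ABC

end

namespace ABC

/-! Everything rests on a tail bound uniform over all sampling laws: the discrepancy between a law
and its empirical measure exceeds `2 * uniformRademacher F n + s` with probability at most exp(-n
s²/(2b²)). Symmetrization bounds the mean by twice the Rademacher complexity; replacing one sample
point moves the discrepancy by at most 2b/n, so McDiarmid controls the excess
(`measure_ghostDeviation_gt_le`).

That discrepancy is a supremum over a possibly uncountable class and need not be measurable. It is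
replaced by the measurable majorant `ghostDeviation`, an average over a second, independent sample,
to which both bounds apply.

The posterior mass of the bad set is a ratio. On the data event where the empirical measure is
ε/3-close to `μstar`, the triangle inequality gives acceptance probability at most ε^L/n on the bad
set (`acceptProb_le_of_lt_ips`) and at least 1/2 on the prior ball of radius ε* + ε/3
(`half_le_acceptProb`), whose mass is at least c(ε/3)^L. The quotient is 2·3^L/(cn), and the tail
bound applied to `μstar` makes the data event likely. -/

/-! ### Exponential moments and McDiarmid's inequality. -/

lemma mgf_sub_const {Y : Type*} [MeasurableSpace Y] (μ : Measure Y) (g : Y → ℝ) (a t : ℝ) :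
    mgf (fun x => g x - a) μ t = mgf g μ t * Real.exp (-(t * a)) := by
  simp only [mgf]
  rw [← integral_mul_const]
  congr with x
  rw [← Real.exp_add, mul_sub, sub_eq_add_neg]

/-- Hoeffding's lemma: oscillation at most `c` confines `g` to the interval of length `c` starting
at its infimum. -/
lemma integral_exp_le_of_forall_sub_le {Y : Type*} [MeasurableSpace Y] (μ : Measure Y)
    [IsProbabilityMeasure μ] {g : Y → ℝ} (hg : Measurable g) {c : ℝ}
    (hd : ∀ x y, g x - g y ≤ c) (t : ℝ) :
    ∫ x, Real.exp (t * g x) ∂μ ≤ Real.exp (t * (∫ x, g x ∂μ) + t ^ 2 * c ^ 2 / 8) := by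
  obtain ⟨x₀⟩ : Nonempty Y := nonempty_of_isProbabilityMeasure μ
  have hbdd : BddBelow (Set.range g) := by
    refine ⟨g x₀ - c, ?_⟩
    rintro _ ⟨x, rfl⟩
    linarith [hd x₀ x]
  have hmem : ∀ x, g x ∈ Set.Icc (⨅ x, g x) ((⨅ x, g x) + c) := by
    have : Nonempty Y := ⟨x₀⟩
    refine fun x => ⟨ciInf_le hbdd x, ?_⟩
    have : g x - c ≤ ⨅ x, g x := le_ciInf fun y => by linarith [hd x y]
    linarith
  have h := (hasSubgaussianMGF_of_mem_Icc hg.aemeasurable (μ := μ)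
    (ae_of_all _ hmem)).mgf_le t
  rw [mgf_sub_const] at h
  have h2 : mgf g μ t = mgf g μ t * Real.exp (-(t * ∫ x, g x ∂μ)) *
      Real.exp (t * ∫ x, g x ∂μ) := by
    rw [mul_assoc, ← Real.exp_add]; simp
  calc ∫ x, Real.exp (t * g x) ∂μ = mgf g μ t := rfl
    _ ≤ _ := by
      rw [h2, add_comm, Real.exp_add]
      gcongr
      refine h.trans_eq ?_
      congr 1
      simp [div_pow]
      ring

/-- Exponential moment bound for functions of independent variables with bounded differences. -/
lemma integral_exp_le_of_bounded_differences {Y : Type*} [MeasurableSpace Y] (μ : Measure Y)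
    [IsProbabilityMeasure μ] {c : ℝ} (t : ℝ) {n : ℕ} {g : (Fin n → Y) → ℝ} (hg : Measurable g)
    {C : ℝ} (hC : ∀ x, |g x| ≤ C) (hd : ∀ x i v, g (Function.update x i v) - g x ≤ c) :
    ∫ x, Real.exp (t * g x) ∂(Measure.pi fun _ => μ) ≤
      Real.exp (t * (∫ x, g x ∂(Measure.pi fun _ => μ)) + t ^ 2 * (n * c ^ 2) / 8) := by
  induction n with
  | zero => simp [integral_unique]
  | succ n ih =>
    have hmp := (measurePreserving_piFinSuccAbove (fun _ : Fin (n + 1) => μ) 0).symm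
    have hcoe : ∀ p : Y × (Fin n → Y),
        (MeasurableEquiv.piFinSuccAbove (fun _ : Fin (n + 1) => Y) 0).symm p
          = (Fin.cons p.1 p.2 : Fin (n + 1) → Y) := fun p => Fin.insertNth_zero' _ _
    have hcons : Measurable fun p : Y × (Fin n → Y) => (Fin.cons p.1 p.2 : Fin (n + 1) → Y) := by
      simpa only [← hcoe] using
        (MeasurableEquiv.piFinSuccAbove (fun _ : Fin (n + 1) => Y) 0).symm.measurable
    have key : ∀ φ : (Fin (n + 1) → Y) → ℝ, Measurable φ → (∃ K, ∀ x, |φ x| ≤ K) →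
        ∫ x, φ x ∂(Measure.pi fun _ => μ) =
          ∫ x, ∫ y, φ (Fin.cons y x) ∂μ ∂(Measure.pi fun _ : Fin n => μ) := by
      rintro φ hφ ⟨K, hK⟩
      rw [← hmp.integral_comp (MeasurableEquiv.measurableEmbedding _)]
      simp only [hcoe]
      rw [integral_prod_symm]
      refine Integrable.of_bound (hφ.comp hcons).aestronglyMeasurable K (ae_of_all _ fun p => ?_)
      exact hK _
    have hexp : ∀ r, |r| ≤ C → |Real.exp (t * r)| ≤ Real.exp (|t| * C) := fun r hr => by
      rw [Real.abs_exp]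
      refine Real.exp_le_exp.2 ((le_abs_self _).trans ?_)
      rw [abs_mul]; gcongr
    -- Integrating out the first coordinate preserves the sup bound and the bounded differences, so
    -- induction applies to `h`; the inner integral costs one Hoeffding factor.
    let h : (Fin n → Y) → ℝ := fun x => ∫ y, g (Fin.cons y x) ∂μ
    have hgc : Measurable fun p : (Fin n → Y) × Y => g (Fin.cons p.2 p.1) :=
      (hg.comp hcons).comp measurable_swap
    have hh : Measurable h :=
      (StronglyMeasurable.integral_prod_right hgc.stronglyMeasurable).measurable
    have hint : ∀ x : Fin n → Y, Integrable (fun y => g (Fin.cons y x)) μ := fun x =>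
      Integrable.of_bound (hgc.comp measurable_prodMk_left).aestronglyMeasurable C
        (ae_of_all _ fun y => hC _)
    have hhC : ∀ x, |h x| ≤ C := fun x => by
      have := norm_integral_le_of_norm_le_const (μ := μ) (f := fun y => g (Fin.cons y x)) (C := C)
        (ae_of_all _ fun y => hC _)
      simpa using this
    have hhd : ∀ x i v, h (Function.update x i v) - h x ≤ c := fun x i v => by
      simp only [h]
      rw [← integral_sub (hint _) (hint _)]
      calc _ ≤ ∫ _, c ∂μ := by
            refine integral_mono ((hint _).sub (hint _)) (integrable_const _) fun y => ?_
            simp only [Fin.cons_update]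
            exact hd _ _ _
        _ = c := by simp
    rw [key _ (by fun_prop) ⟨_, fun x => hexp _ (hC x)⟩, key g hg ⟨C, hC⟩]
    calc _ ≤ ∫ x, Real.exp (t * h x) * Real.exp (t ^ 2 * c ^ 2 / 8)
            ∂(Measure.pi fun _ : Fin n => μ) := by
          refine integral_mono_of_nonneg (ae_of_all _ fun x => integral_nonneg fun y => by positivity)
            ?_ (ae_of_all _ fun x => ?_)
          · refine Integrable.mul_const ?_ _
            exact Integrable.of_bound (by fun_prop) _ (ae_of_all _ fun x => hexp _ (hhC x))
          · simp only
            rw [← Real.exp_add]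
            refine integral_exp_le_of_forall_sub_le μ (hgc.comp measurable_prodMk_left)
              (fun y z => ?_) t
            have := hd (Fin.cons z x) 0 y
            rwa [Fin.update_cons_zero] at this
      _ = (∫ x, Real.exp (t * h x) ∂(Measure.pi fun _ : Fin n => μ)) *
            Real.exp (t ^ 2 * c ^ 2 / 8) := integral_mul_const _ _
      _ ≤ Real.exp (t * (∫ x, h x ∂(Measure.pi fun _ => μ)) + t ^ 2 * (n * c ^ 2) / 8) *
            Real.exp (t ^ 2 * c ^ 2 / 8) := by
          gcongr
          exact ih hh hhC hhd
      _ = _ := by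
          rw [← Real.exp_add]
          congr 1
          simp only [h]
          push_cast
          ring

/-- **McDiarmid's inequality** for identically distributed variables. -/
lemma measureReal_ge_le_of_bounded_differences {Y : Type*} [MeasurableSpace Y] (μ : Measure Y)
    [IsProbabilityMeasure μ] {c : ℝ} {n : ℕ} {g : (Fin n → Y) → ℝ} (hg : Measurable g)
    {C : ℝ} (hC : ∀ x, |g x| ≤ C) (hd : ∀ x i v, g (Function.update x i v) - g x ≤ c)
    {s : ℝ} (hs : 0 ≤ s) :
    (Measure.pi fun _ => μ).real {x | (∫ x, g x ∂(Measure.pi fun _ => μ)) + s ≤ g x} ≤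
      Real.exp (-(2 * s ^ 2 / (n * c ^ 2))) := by
  -- The variance proxy v = nc²/4 matches t²v/2 with the exponent t²nc²/8.
  have hsub : HasSubgaussianMGF (fun x => g x - ∫ x, g x ∂(Measure.pi fun _ => μ))
      (Real.toNNReal (n * c ^ 2 / 4)) (Measure.pi fun _ => μ) := by
    refine ⟨fun t => ?_, fun t => ?_⟩
    · refine Integrable.of_bound (C := Real.exp (|t| * (C + |∫ x, g x ∂(Measure.pi fun _ => μ)|)))
        (by fun_prop) (ae_of_all _ fun x => ?_)
      rw [Real.norm_eq_abs, Real.abs_exp]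
      refine Real.exp_le_exp.2 ((le_abs_self _).trans ?_)
      rw [abs_mul]
      gcongr
      exact (abs_sub _ _).trans (by gcongr; exact hC x)
    · rw [mgf_sub_const, Real.coe_toNNReal _ (by positivity)]
      have := integral_exp_le_of_bounded_differences μ t hg hC hd
      calc _ ≤ Real.exp (t * (∫ x, g x ∂(Measure.pi fun _ => μ)) + t ^ 2 * (n * c ^ 2) / 8) *
            Real.exp (-(t * ∫ x, g x ∂(Measure.pi fun _ => μ))) := by
              gcongr
              exact this
        _ = _ := by rw [← Real.exp_add]; congr 1; ring
  have h := hsub.measure_ge_le hs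
  rw [Real.coe_toNNReal _ (by positivity)] at h
  convert h using 2
  · ext x; simp only [Set.mem_ofPred_eq]; constructor <;> intro h <;> linarith
  · rw [neg_div]; congr 1
    rw [show 2 * (n * c ^ 2 / 4) = (n * c ^ 2) / 2 by ring, div_div_eq_mul_div, mul_comm]

/-! ### Pointwise properties of the semimetric on empirical measures. -/

section Deterministic

variable {Y : Type*} [MeasurableSpace Y] {F : Set (Y → ℝ)}

lemma ips_comm (μ ν : Measure Y) : ips F μ ν = ips F ν μ := by
  simp only [ips, abs_sub_comm]

lemma ips_triangle (μ ν ξ : Measure Y) : ips F μ ξ ≤ ips F μ ν + ips F ν ξ := by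
  refine iSup₂_le fun f hf => ?_
  calc _ ≤ ENNReal.ofReal (|(∫ y, f y ∂μ) - ∫ y, f y ∂ν| + |(∫ y, f y ∂ν) - ∫ y, f y ∂ξ|) :=
        ENNReal.ofReal_le_ofReal (abs_sub_le _ _ _)
    _ = _ := ENNReal.ofReal_add (abs_nonneg _) (abs_nonneg _)
    _ ≤ _ := add_le_add
        (le_iSup₂ (f := fun f (_ : f ∈ F) => ENNReal.ofReal |(∫ y, f y ∂μ) - ∫ y, f y ∂ν|) f hf)
        (le_iSup₂ (f := fun f (_ : f ∈ F) => ENNReal.ofReal |(∫ y, f y ∂ν) - ∫ y, f y ∂ξ|) f hf)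

lemma integral_empirical {f : Y → ℝ} (hf : Measurable f) {n : ℕ} (x : Fin n → Y) :
    ∫ y, f y ∂(empirical x) = (1 / (n : ℝ)) * ∑ i, f (x i) := by
  rw [empirical, integral_smul_measure, integral_finsetSum_measure]
  · simp [integral_dirac' _ _ hf.stronglyMeasurable]
  · intro i _
    exact integrable_dirac' hf.stronglyMeasurable (by simp)

/-- Transfers the measurability assumed of `rademacherSup`, at sample size 2n, to the semimetric.
The factor 2 compensates the normalization 1/(2n). -/
lemma ips_empirical_eq (hF : ∀ f ∈ F, Measurable f) {n : ℕ} (x x' : Fin n → Y) :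
    ips F (empirical x) (empirical x') =
      2 * rademacherSup F (Fin.append (fun _ : Fin n => 1) (fun _ : Fin n => -1))
        (Fin.append x x') := by
  simp only [ips, rademacherSup, ENNReal.mul_iSup]
  refine iSup_congr fun f => iSup_congr fun hf => ?_
  rw [integral_empirical (hF f hf), integral_empirical (hF f hf),
    show (2 : ℝ≥0∞) = ENNReal.ofReal 2 by simp, ← ENNReal.ofReal_mul (by norm_num),
    ← abs_two (α := ℝ), ← abs_mul]
  congr 2
  rw [Fin.sum_univ_add]
  simp only [Fin.append_left, Fin.append_right]
  rcases Nat.eq_zero_or_pos n with rfl | hn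
  · simp
  · push_cast
    simp only [Finset.sum_neg_distrib, one_mul, neg_mul]
    have : (n : ℝ) ≠ 0 := by positivity
    field_simp
    ring

lemma ips_empirical_update_le (hF : ∀ f ∈ F, Measurable f) {b : ℝ} (hb : ∀ f ∈ F, ∀ x, |f x| ≤ b)
    {n : ℕ} (x : Fin n → Y) (i : Fin n) (v : Y) :
    ips F (empirical (Function.update x i v)) (empirical x) ≤ ENNReal.ofReal (2 * b / n) := by
  refine iSup₂_le fun f hf => ENNReal.ofReal_le_ofReal ?_
  rw [integral_empirical (hF f hf), integral_empirical (hF f hf), ← mul_sub,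
    ← Finset.sum_sub_distrib, Finset.sum_eq_single i]
  · rw [Function.update_self, abs_mul, abs_of_nonneg (by positivity), mul_comm, mul_one_div]
    gcongr
    calc _ ≤ |f v| + |f (x i)| := abs_sub _ _
      _ ≤ 2 * b := by linarith [hb f hf v, hb f hf (x i)]
  · intro j _ hj
    simp [Function.update_of_ne hj]
  · simp

lemma ips_le {b : ℝ} (hb : ∀ f ∈ F, ∀ x, |f x| ≤ b) (μ ν : Measure Y) [IsProbabilityMeasure μ]
    [IsProbabilityMeasure ν] : ips F μ ν ≤ ENNReal.ofReal (2 * b) := by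
  refine iSup₂_le fun f hf => ENNReal.ofReal_le_ofReal ?_
  have h (ξ : Measure Y) [IsProbabilityMeasure ξ] : |∫ y, f y ∂ξ| ≤ b := by
    simpa using norm_integral_le_of_norm_le_const (μ := ξ) (f := f) (ae_of_all _ fun y => hb f hf y)
  calc _ ≤ |∫ y, f y ∂μ| + |∫ y, f y ∂ν| := abs_sub _ _
    _ ≤ 2 * b := by linarith [h μ, h ν]

lemma isProbabilityMeasure_empirical {n : ℕ} (hn : n ≠ 0) (x : Fin n → Y) :
    IsProbabilityMeasure (empirical x) := by
  constructor
  simp [empirical, ENNReal.inv_mul_cancel, hn]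

/-- Exchanging the pair `x i`, `x' i` flips the sign of the i-th summand, which produces the
Rademacher signs. -/
lemma ips_empirical_swap_le (hF : ∀ f ∈ F, Measurable f) {n : ℕ} (ε : Fin n → ℤˣ)
    (x x' : Fin n → Y) :
    ips F (empirical fun i => if ε i = 1 then x i else x' i)
        (empirical fun i => if ε i = 1 then x' i else x i) ≤
      rademacherSup F ε x + rademacherSup F ε x' := by
  refine iSup₂_le fun f hf => ?_
  rw [integral_empirical (hF f hf), integral_empirical (hF f hf), ← mul_sub,
    ← Finset.sum_sub_distrib]
  have key : (1 / (n : ℝ)) * ∑ i, (f (if ε i = 1 then x i else x' i) -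
      f (if ε i = 1 then x' i else x i)) =
      (1 / (n : ℝ)) * ∑ i, ((ε i : ℤ) : ℝ) * f (x i) -
        (1 / (n : ℝ)) * ∑ i, ((ε i : ℤ) : ℝ) * f (x' i) := by
    rw [← mul_sub, ← Finset.sum_sub_distrib]
    congr 1
    refine Finset.sum_congr rfl fun i _ => ?_
    rcases Int.units_eq_one_or (ε i) with h | h
    · simp [h]
    · simp [h]
      ring
  rw [key]
  calc _ ≤ ENNReal.ofReal (|(1 / (n : ℝ)) * ∑ i, ((ε i : ℤ) : ℝ) * f (x i)| +
        |(1 / (n : ℝ)) * ∑ i, ((ε i : ℤ) : ℝ) * f (x' i)|) :=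
        ENNReal.ofReal_le_ofReal (abs_sub _ _)
    _ = _ := ENNReal.ofReal_add (abs_nonneg _) (abs_nonneg _)
    _ ≤ _ := add_le_add
        (le_iSup₂ (f := fun f (_ : f ∈ F) =>
          ENNReal.ofReal |(1 / (n : ℝ)) * ∑ i, ((ε i : ℤ) : ℝ) * f (x i)|) f hf)
        (le_iSup₂ (f := fun f (_ : f ∈ F) =>
          ENNReal.ofReal |(1 / (n : ℝ)) * ∑ i, ((ε i : ℤ) : ℝ) * f (x' i)|) f hf)

end Deterministic

/-! ### Symmetrization and the uniform deviation bound. -/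

section Deviation

variable {Y : Type*} [MeasurableSpace Y] {F : Set (Y → ℝ)}

lemma measurable_ips_empirical (hF : ∀ f ∈ F, Measurable f)
    (hFmeas : ∀ (n : ℕ) (ε : Fin n → ℤˣ), Measurable fun x : Fin n → Y => rademacherSup F ε x)
    (n : ℕ) :
    Measurable fun p : (Fin n → Y) × (Fin n → Y) => ips F (empirical p.1) (empirical p.2) := by
  simp only [ips_empirical_eq hF]
  refine ((hFmeas (n + n) _).comp (measurable_pi_iff.2 fun i => ?_)).const_mul 2
  refine Fin.addCases (fun i => ?_) (fun i => ?_) i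
  · simp only [Fin.append_left]; fun_prop
  · simp only [Fin.append_right]; fun_prop

/-- The mean of the semimetric between the empirical measure of `x` and that of an independent
i.i.d. sample from `μ`. It is a measurable majorant of `ips F (empirical x) μ`. -/
noncomputable def ghostDeviation (F : Set (Y → ℝ)) (μ : Measure Y) {n : ℕ} (x : Fin n → Y) : ℝ≥0∞ :=
  ∫⁻ x' : Fin n → Y, ips F (empirical x) (empirical x') ∂(Measure.pi fun _ => μ)

lemma measurable_ghostDeviation (hF : ∀ f ∈ F, Measurable f)
    (hFmeas : ∀ (n : ℕ) (ε : Fin n → ℤˣ), Measurable fun x : Fin n → Y => rademacherSup F ε x)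
    (μ : Measure Y) [IsProbabilityMeasure μ] (n : ℕ) :
    Measurable fun x : Fin n → Y => ghostDeviation F μ x :=
  (measurable_ips_empirical hF hFmeas n).lintegral_prod_right'

/-- Jensen: ∫ f dμ is the mean of the ghost sample's empirical integral, so the absolute value and
the supremum move inside the expectation. -/
lemma ips_empirical_le_ghostDeviation (hF : ∀ f ∈ F, Measurable f) {b : ℝ}
    (hb : ∀ f ∈ F, ∀ x, |f x| ≤ b) (μ : Measure Y) [IsProbabilityMeasure μ] {n : ℕ} (hn : n ≠ 0)
    (x : Fin n → Y) : ips F (empirical x) μ ≤ ghostDeviation F μ x := by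
  refine iSup₂_le fun f hf => ?_
  set ν : Measure (Fin n → Y) := Measure.pi fun _ => μ
  have hcoord (i : Fin n) : Integrable (fun x' : Fin n → Y => f (x' i)) ν :=
    Integrable.of_bound ((hF f hf).comp (measurable_pi_apply i)).aestronglyMeasurable b
      (ae_of_all _ fun x' => hb f hf _)
  have hint : Integrable (fun x' : Fin n → Y => ∫ y, f y ∂(empirical x')) ν := by
    simp only [integral_empirical (hF f hf)]
    exact (integrable_finsetSum _ fun i _ => hcoord i).const_mul _
  have hmean : ∫ x', (∫ y, f y ∂(empirical x')) ∂ν = ∫ y, f y ∂μ := by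
    simp only [integral_empirical (hF f hf)]
    rw [integral_const_mul, integral_finsetSum _ fun i _ => hcoord i]
    have (i : Fin n) : ∫ x', f (x' i) ∂ν = ∫ y, f y ∂μ :=
      integral_comp_eval (hF f hf).aestronglyMeasurable
    have hn' : (n : ℝ) ≠ 0 := by exact_mod_cast hn
    simp [this, hn']
  have hconst : ∫ _x', (∫ y, f y ∂(empirical x)) ∂ν = ∫ y, f y ∂(empirical x) := by simp
  rw [← hmean, ← hconst, ← integral_sub (integrable_const _) hint, ← Real.norm_eq_abs,
    ofReal_norm]
  refine (enorm_integral_le_lintegral_enorm _).trans (lintegral_mono fun x' => ?_)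
  rw [← ofReal_norm, Real.norm_eq_abs]
  exact le_iSup₂ (f := fun f (_ : f ∈ F) =>
    ENNReal.ofReal |(∫ y, f y ∂(empirical x)) - ∫ y, f y ∂(empirical x')|) f hf

/-- Viewed as a vector of i.i.d. pairs, the two samples are swapped coordinate by coordinate, and
each swap preserves `μ.prod μ`. -/
lemma measurePreserving_conditionalSwap (μ : Measure Y) [IsProbabilityMeasure μ] {n : ℕ}
    (p : Fin n → Prop) [DecidablePred p] :
    MeasurePreserving (fun q : (Fin n → Y) × (Fin n → Y) =>
        ((fun i => if p i then q.1 i else q.2 i, fun i => if p i then q.2 i else q.1 i) :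
          (Fin n → Y) × (Fin n → Y)))
      ((Measure.pi fun _ => μ).prod (Measure.pi fun _ => μ))
      ((Measure.pi fun _ => μ).prod (Measure.pi fun _ => μ)) := by
  have e := measurePreserving_arrowProdEquivProdArrow Y Y (Fin n) (fun _ => μ) (fun _ => μ)
  have hs := measurePreserving_pi (fun _ : Fin n => μ.prod μ) (fun _ => μ.prod μ)
    (f := fun i q => if p i then q else q.swap) fun i => by
      by_cases h : p i
      · simp only [h, if_true]
        exact MeasurePreserving.id _
      · simpa [h] using Measure.measurePreserving_swap
  convert e.comp (hs.comp e.symm) using 1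
  ext q i <;> by_cases h : p i <;>
    simp [h, MeasurableEquiv.arrowProdEquivProdArrow, Equiv.arrowProdEquivProdArrow]

/-- Symmetrization. -/
lemma lintegral_ghostDeviation_le (hF : ∀ f ∈ F, Measurable f)
    (hFmeas : ∀ (n : ℕ) (ε : Fin n → ℤˣ), Measurable fun x : Fin n → Y => rademacherSup F ε x)
    (μ : Measure Y) [IsProbabilityMeasure μ] (n : ℕ) :
    ∫⁻ x : Fin n → Y, ghostDeviation F μ x ∂(Measure.pi fun _ => μ) ≤
      2 * rademacherComplexity F μ n := by
  set ν : Measure (Fin n → Y) := Measure.pi fun _ => μ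
  set D := ∫⁻ x : Fin n → Y, ghostDeviation F μ x ∂ν
  have hm := measurable_ips_empirical hF hFmeas n
  have hD : D = ∫⁻ p, ips F (empirical p.1) (empirical p.2) ∂(ν.prod ν) :=
    (lintegral_prod _ hm.aemeasurable).symm
  -- The bound holds for each fixed sign pattern; averaging over all 2^n patterns then gives the
  -- complexity.
  have hε (ε : Fin n → ℤˣ) : D ≤ 2 * ∫⁻ x, rademacherSup F ε x ∂ν := by
    rw [hD, ← (measurePreserving_conditionalSwap μ fun i => ε i = 1).lintegral_comp hm]
    calc _ ≤ ∫⁻ p : (Fin n → Y) × (Fin n → Y), rademacherSup F ε p.1 + rademacherSup F ε p.2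
            ∂(ν.prod ν) := lintegral_mono fun p => ips_empirical_swap_le hF ε p.1 p.2
      _ = _ := by
        rw [lintegral_add_left (f := fun p : (Fin n → Y) × (Fin n → Y) => rademacherSup F ε p.1)
            ((hFmeas n ε).comp measurable_fst),
          measurePreserving_fst.lintegral_comp (hFmeas n ε),
          measurePreserving_snd.lintegral_comp (hFmeas n ε), two_mul]
  rw [rademacherComplexity, lintegral_const_mul _ (Finset.measurable_fun_sum _ fun ε _ => hFmeas n ε),
    lintegral_finsetSum _ fun ε _ => hFmeas n ε, mul_left_comm, Finset.mul_sum]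
  calc D = ((2 : ℝ≥0∞) ^ n)⁻¹ * ∑ _ε : Fin n → ℤˣ, D := by
        simp only [Finset.sum_const, Finset.card_univ, Fintype.card_fun, Fintype.card_units_int,
          Fintype.card_fin, nsmul_eq_mul, Nat.cast_pow, Nat.cast_ofNat]
        rw [← mul_assoc, ENNReal.inv_mul_cancel (by simp) (by simp), one_mul]
    _ ≤ _ := by gcongr with ε; exact hε ε

/-- Uniform law of large numbers with an exponential tail. -/
lemma measure_ghostDeviation_gt_le (hF : ∀ f ∈ F, Measurable f)
    (hFmeas : ∀ (n : ℕ) (ε : Fin n → ℤˣ), Measurable fun x : Fin n → Y => rademacherSup F ε x)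
    {b : ℝ} (hb0 : 0 < b) (hb : ∀ f ∈ F, ∀ x, |f x| ≤ b) (μ : Measure Y) [IsProbabilityMeasure μ]
    {n : ℕ} (hn : n ≠ 0) {s : ℝ} (hs : 0 ≤ s) :
    (Measure.pi fun _ : Fin n => μ)
        {x | 2 * uniformRademacher F n + ENNReal.ofReal s < ghostDeviation F μ x} ≤
      ENNReal.ofReal (Real.exp (-(n * s ^ 2 / (2 * b ^ 2)))) := by
  set ν : Measure (Fin n → Y) := Measure.pi fun _ => μ
  have hle (x : Fin n → Y) : ghostDeviation F μ x ≤ ENNReal.ofReal (2 * b) := by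
    calc _ ≤ ∫⁻ _, ENNReal.ofReal (2 * b) ∂ν := lintegral_mono fun x' => by
          have := isProbabilityMeasure_empirical hn x
          have := isProbabilityMeasure_empirical hn x'
          exact ips_le hb _ _
      _ = _ := by simp
  have hfin (x : Fin n → Y) : ghostDeviation F μ x ≠ ∞ :=
    ((hle x).trans_lt ENNReal.ofReal_lt_top).ne
  have hupd (x : Fin n → Y) (i : Fin n) (v : Y) :
      ghostDeviation F μ (Function.update x i v) ≤
        ENNReal.ofReal (2 * b / n) + ghostDeviation F μ x := by
    calc _ ≤ ∫⁻ x', (ENNReal.ofReal (2 * b / n) + ips F (empirical x) (empirical x')) ∂ν :=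
          lintegral_mono fun x' => (ips_triangle _ (empirical x) _).trans
            (add_le_add_left (ips_empirical_update_le hF hb x i v) _)
      _ = _ := by
          rw [lintegral_add_left measurable_const]
          simp [ghostDeviation, ν]
  have hmG := measurable_ghostDeviation hF hFmeas μ n
  let g : (Fin n → Y) → ℝ := fun x => (ghostDeviation F μ x).toReal
  have hmean : ENNReal.ofReal (∫ x, g x ∂ν) ≤ 2 * uniformRademacher F n := by
    rw [integral_toReal hmG.aemeasurable (ae_of_all _ fun x => (hfin x).lt_top)]
    refine ENNReal.ofReal_toReal_le.trans
      ((lintegral_ghostDeviation_le hF hFmeas μ n).trans ?_)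
    gcongr
    exact le_iSup (fun μ : ProbabilityMeasure Y => rademacherComplexity F (μ : Measure Y) n)
      ⟨μ, inferInstance⟩
  have hmc := measureReal_ge_le_of_bounded_differences μ (g := g) (c := 2 * b / n) (C := 2 * b)
    hmG.ennreal_toReal (fun x => ?_) (fun x i v => ?_) hs
  · rw [← ENNReal.ofReal_le_ofReal_iff (Real.exp_pos _).le, Measure.real,
      ENNReal.ofReal_toReal (measure_ne_top _ _)] at hmc
    refine (measure_mono fun x hx => ?_).trans (hmc.trans (le_of_eq ?_))
    · have h0 : 0 ≤ ∫ x, g x ∂ν := integral_nonneg fun _ => ENNReal.toReal_nonneg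
      refine (ENNReal.ofReal_le_iff_le_toReal (hfin x)).1 ?_
      rw [ENNReal.ofReal_add h0 hs]
      exact (add_le_add_left hmean _).trans (le_of_lt hx)
    · congr 3
      have : (n : ℝ) ≠ 0 := by exact_mod_cast hn
      field_simp
  · rw [abs_of_nonneg ENNReal.toReal_nonneg]
    exact ENNReal.toReal_le_of_le_ofReal (by positivity) (hle x)
  · rw [sub_le_iff_le_add]
    have := ENNReal.toReal_mono (ENNReal.add_ne_top.2 ⟨ENNReal.ofReal_ne_top, hfin x⟩) (hupd x i v)
    rwa [ENNReal.toReal_add ENNReal.ofReal_ne_top (hfin x),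
      ENNReal.toReal_ofReal (by positivity)] at this

end Deviation

/-! ### Acceptance probabilities and posterior concentration. -/

section Posterior

variable {Y Θ : Type*} [MeasurableSpace Y] [MeasurableSpace Θ] {F : Set (Y → ℝ)}

lemma measurable_pi_kernel (model : Kernel Θ Y) [IsMarkovKernel model] (n : ℕ) :
    Measurable fun θ => Measure.pi fun _ : Fin n => model θ := by
  refine Measurable.measure_of_isPiSystem_of_isProbabilityMeasure generateFrom_pi.symm
    isPiSystem_pi ?_
  rintro _ ⟨t, ht, rfl⟩
  simp only [Measure.pi_pi]
  exact Finset.measurable_fun_prod _ fun i _ => model.measurable_coe (ht i (Set.mem_univ i))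

lemma measurable_acceptProb (hF : ∀ f ∈ F, Measurable f)
    (hFmeas : ∀ (n : ℕ) (ε : Fin n → ℤˣ), Measurable fun x : Fin n → Y => rademacherSup F ε x)
    (model : Kernel Θ Y) [IsMarkovKernel model] {n : ℕ} (y : Fin n → Y) (ε : ℝ≥0∞) :
    Measurable (acceptProb F model y ε) := by
  have h : MeasurableSet {z : Fin n → Y | ips F (empirical z) (empirical y) ≤ ε} :=
    measurableSet_le (((measurable_ips_empirical hF hFmeas n).comp
      (measurable_prodMk_right (y := y)) :)) measurable_const
  exact (Measure.measurable_coe h).comp (measurable_pi_kernel model n)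

lemma acceptProb_le_one (model : Kernel Θ Y) [IsMarkovKernel model] {n : ℕ} (y : Fin n → Y)
    (ε : ℝ≥0∞) (θ : Θ) : acceptProb F model y ε θ ≤ 1 := prob_le_one

lemma isProbabilityMeasure_abcPosterior (model : Kernel Θ Y) [IsMarkovKernel model]
    (prior : Measure Θ) [IsProbabilityMeasure prior] {n : ℕ} {y : Fin n → Y} {ε : ℝ≥0∞}
    (h : prior.withDensity (acceptProb F model y ε) Set.univ ≠ 0) :
    IsProbabilityMeasure (abcPosterior F model prior y ε) := by
  constructor
  rw [abcPosterior, Measure.smul_apply, smul_eq_mul, ENNReal.inv_mul_cancel h]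
  rw [withDensity_apply _ MeasurableSet.univ, Measure.restrict_univ]
  refine (lt_of_le_of_lt (lintegral_mono (acceptProb_le_one model y ε)) ?_).ne
  simp

/-- Upper bound on the acceptance probability at a parameter far from `μstar`. -/
lemma acceptProb_le_of_lt_ips (hF : ∀ f ∈ F, Measurable f)
    (hFmeas : ∀ (n : ℕ) (ε : Fin n → ℤˣ), Measurable fun x : Fin n → Y => rademacherSup F ε x)
    {b : ℝ} (hb0 : 0 < b) (hb : ∀ f ∈ F, ∀ x, |f x| ≤ b) (model : Kernel Θ Y) [IsMarkovKernel model]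
    {μstar : Measure Y} {n : ℕ} (hn : n ≠ 0) {y : Fin n → Y} {ε δ : ℝ≥0∞}
    (hy : ips F (empirical y) μstar ≤ δ) {s : ℝ} (hs : 0 ≤ s) {θ : Θ}
    (hθ : ε + δ + (2 * uniformRademacher F n + ENNReal.ofReal s) < ips F (model θ) μstar) :
    acceptProb F model y ε θ ≤ ENNReal.ofReal (Real.exp (-(n * s ^ 2 / (2 * b ^ 2)))) := by
  refine (measure_mono fun z hz => ?_).trans
    (measure_ghostDeviation_gt_le hF hFmeas hb0 hb (model θ) hn hs)
  have h : ips F (model θ) μstar ≤ ε + δ + ghostDeviation F (model θ) z := by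
    calc _ ≤ ips F (model θ) (empirical z) +
          (ips F (empirical z) (empirical y) + ips F (empirical y) μstar) :=
          (ips_triangle _ (empirical z) _).trans (by gcongr; exact ips_triangle _ _ _)
      _ ≤ ghostDeviation F (model θ) z + (ε + δ) := by
          gcongr
          · rw [ips_comm]
            exact ips_empirical_le_ghostDeviation hF hb (model θ) hn z
          · exact hz
      _ = _ := add_comm _ _
  exact lt_of_add_lt_add_left (hθ.trans_le h)

/-- Lower bound on the acceptance probability at a parameter close to `μstar`. -/
lemma half_le_acceptProb (hF : ∀ f ∈ F, Measurable f)
    (hFmeas : ∀ (n : ℕ) (ε : Fin n → ℤˣ), Measurable fun x : Fin n → Y => rademacherSup F ε x)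
    {b : ℝ} (hb0 : 0 < b) (hb : ∀ f ∈ F, ∀ x, |f x| ≤ b) (model : Kernel Θ Y) [IsMarkovKernel model]
    {μstar : Measure Y} {n : ℕ} (hn : n ≠ 0) {y : Fin n → Y} {ε δ : ℝ≥0∞}
    (hy : ips F (empirical y) μstar ≤ δ) {s : ℝ} (hs : 0 ≤ s)
    (hs2 : Real.exp (-(n * s ^ 2 / (2 * b ^ 2))) ≤ 1 / 2) {θ : Θ}
    (hθ : ips F (model θ) μstar + δ + (2 * uniformRademacher F n + ENNReal.ofReal s) ≤ ε) :
    1 / 2 ≤ acceptProb F model y ε θ := by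
  set ν : Measure (Fin n → Y) := Measure.pi fun _ => model θ
  set B := {z : Fin n → Y |
    2 * uniformRademacher F n + ENNReal.ofReal s < ghostDeviation F (model θ) z}
  have hB : MeasurableSet B :=
    measurableSet_lt measurable_const (measurable_ghostDeviation hF hFmeas (model θ) n)
  have hνB : ν B ≤ 1 / 2 := by
    refine (measure_ghostDeviation_gt_le hF hFmeas hb0 hb (model θ) hn hs).trans ?_
    refine (ENNReal.ofReal_le_ofReal hs2).trans_eq ?_
    simp
  calc (1 / 2 : ℝ≥0∞) = 1 - 1 / 2 := by simp
    _ ≤ 1 - ν B := tsub_le_tsub_left hνB _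
    _ = ν Bᶜ := (prob_compl_eq_one_sub hB).symm
    _ ≤ _ := measure_mono fun z hz => ?_
  have hz' : ghostDeviation F (model θ) z ≤ 2 * uniformRademacher F n + ENNReal.ofReal s :=
    not_lt.1 hz
  calc _ ≤ ips F (empirical z) (model θ) + (ips F (model θ) μstar + ips F μstar (empirical y)) :=
        (ips_triangle _ (model θ) _).trans (by gcongr; exact ips_triangle _ _ _)
    _ ≤ (2 * uniformRademacher F n + ENNReal.ofReal s) + (ips F (model θ) μstar + δ) := by
        gcongr
        · exact (ips_empirical_le_ghostDeviation hF hb (model θ) hn z).trans hz'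
        · rwa [ips_comm]
    _ ≤ ε := by rwa [add_comm]

/-- The argument for fixed data: `hy` is the only property of the sample that is needed. -/
lemma abcPosterior_concentration (hF : ∀ f ∈ F, Measurable f)
    (hFmeas : ∀ (n : ℕ) (ε : Fin n → ℤˣ), Measurable fun x : Fin n → Y => rademacherSup F ε x)
    {b : ℝ} (hb0 : 0 < b) (hb : ∀ f ∈ F, ∀ x, |f x| ≤ b) (model : Kernel Θ Y) [IsMarkovKernel model]
    (prior : Measure Θ) [IsProbabilityMeasure prior] {μstar : Measure Y} {n : ℕ} (hn : n ≠ 0)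
    {y : Fin n → Y} {e : ℝ≥0∞} {ε L c : ℝ} (hε : 0 < ε) (hc : 0 < c)
    (hR : 2 * uniformRademacher F n ≤ ENNReal.ofReal (ε / 6))
    (hlog : 1 ≤ n / ε ^ L) (hexp : Real.exp (-(n * (ε / 6) ^ 2 / (2 * b ^ 2))) ≤ 1 / 2)
    (hprior : ENNReal.ofReal (c * (ε / 3) ^ L) ≤
      prior {θ | ips F (model θ) μstar ≤ e + ENNReal.ofReal (ε / 3)})
    (hy : ips F (empirical y) μstar ≤ ENNReal.ofReal (ε / 3)) :
    IsProbabilityMeasure (abcPosterior F model prior y (e + ENNReal.ofReal ε)) ∧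
      abcPosterior F model prior y (e + ENNReal.ofReal ε)
        {θ | ips F (model θ) μstar > e + ENNReal.ofReal (4 * ε / 3) + 2 * uniformRademacher F n
          + ENNReal.ofReal (Real.sqrt (2 * b ^ 2 / n * Real.log (n / ε ^ L)))} ≤
        ENNReal.ofReal (2 * 3 ^ L / (c * n)) := by
  set a := acceptProb F model y (e + ENNReal.ofReal ε)
  set s := Real.sqrt (2 * b ^ 2 / n * Real.log (n / ε ^ L)) with hs_def
  set B := {θ | ips F (model θ) μstar > e + ENNReal.ofReal (4 * ε / 3) + 2 * uniformRademacher F n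
    + ENNReal.ofReal s}
  have hn0 : (0 : ℝ) < n := by positivity
  have hεL : 0 < ε ^ L := Real.rpow_pos_of_pos hε L
  have ha : Measurable a := measurable_acceptProb hF hFmeas model y _
  have hlower : ENNReal.ofReal (c * (ε / 3) ^ L / 2) ≤ prior.withDensity a Set.univ := by
    rw [withDensity_apply _ MeasurableSet.univ, Measure.restrict_univ]
    calc ENNReal.ofReal (c * (ε / 3) ^ L / 2) = 1 / 2 * ENNReal.ofReal (c * (ε / 3) ^ L) := by
          rw [div_eq_inv_mul, ENNReal.ofReal_mul (by norm_num)]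
          simp [ENNReal.ofReal_inv_of_pos]
      _ ≤ 1 / 2 * prior {θ | 1 / 2 ≤ a θ} := by
          gcongr
          refine hprior.trans (measure_mono fun θ hθ => ?_)
          refine half_le_acceptProb hF hFmeas hb0 hb model hn hy (by positivity) hexp ?_
          -- Error budget: ε/3 for the parameter, ε/3 for the data, ε/6 for the complexity and ε/6
          -- for the deviation of the synthetic sample.
          calc _ ≤ e + ENNReal.ofReal (ε / 3) + ENNReal.ofReal (ε / 3) +
                (ENNReal.ofReal (ε / 6) + ENNReal.ofReal (ε / 6)) := by
                gcongr
                exact hθ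
            _ = _ := by
                rw [add_assoc, add_assoc, ← ENNReal.ofReal_add (by positivity) (by positivity),
                  ← ENNReal.ofReal_add (by positivity) (by positivity),
                  ← ENNReal.ofReal_add (by positivity) (by positivity)]
                ring_nf
      _ ≤ _ := mul_meas_ge_le_lintegral ha _
  have hupper : prior.withDensity a B ≤ ENNReal.ofReal (ε ^ L / n) := by
    -- `B` is not known to be measurable, so it is enclosed in a sublevel set of `a`. The radius `s`
    -- solves exp(-n s²/(2b²)) = ε^L/n, and 4ε/3 is the threshold ε plus the data error ε/3.
    have hBsub : B ⊆ {θ | a θ ≤ ENNReal.ofReal (ε ^ L / n)} := fun θ hθ => by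
      refine (acceptProb_le_of_lt_ips hF hFmeas hb0 hb model hn hy (s := s)
        (Real.sqrt_nonneg _) (lt_of_eq_of_lt ?_ hθ)).trans_eq ?_
      · rw [← add_assoc, add_assoc e, ← ENNReal.ofReal_add (by positivity) (by positivity)]
        ring_nf
      · have hl : 0 ≤ Real.log (n / ε ^ L) := Real.log_nonneg hlog
        rw [hs_def, Real.sq_sqrt (by positivity)]
        rw [show n * (2 * b ^ 2 / n * Real.log (n / ε ^ L)) / (2 * b ^ 2) = Real.log (n / ε ^ L) by
          field_simp, Real.exp_neg, Real.exp_log (by positivity), inv_div]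
    have hT : MeasurableSet {θ | a θ ≤ ENNReal.ofReal (ε ^ L / n)} :=
      measurableSet_le ha measurable_const
    refine (measure_mono hBsub).trans ?_
    rw [withDensity_apply _ hT]
    refine (setLIntegral_mono (s := {θ | a θ ≤ ENNReal.ofReal (ε ^ L / n)})
      (g := fun _ => ENNReal.ofReal (ε ^ L / n)) measurable_const
      fun θ (hθ : a θ ≤ _) => hθ).trans ?_
    rw [setLIntegral_const]
    exact mul_le_of_le_one_right' prob_le_one
  have hpos : 0 < c * (ε / 3) ^ L / 2 := by
    have := Real.rpow_pos_of_pos (by positivity : 0 < ε / 3) L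
    positivity
  refine ⟨isProbabilityMeasure_abcPosterior model prior
    ((ENNReal.ofReal_pos.2 hpos).trans_le hlower).ne', ?_⟩
  rw [abcPosterior, Measure.smul_apply, smul_eq_mul]
  calc _ ≤ (ENNReal.ofReal (c * (ε / 3) ^ L / 2))⁻¹ * ENNReal.ofReal (ε ^ L / n) := by
        gcongr
    _ = _ := by
        rw [← ENNReal.ofReal_inv_of_pos hpos, ← ENNReal.ofReal_mul (by positivity),
          Real.div_rpow hε.le (by norm_num)]
        congr 1
        have : (0 : ℝ) < 3 ^ L := Real.rpow_pos_of_pos (by norm_num) L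
        field_simp

end Posterior

end ABC

/-! ### Assembly: the data event has probability tending to one. -/

theorem theorem2
    {Y Θ Ω : Type*} [MeasurableSpace Y] [MeasurableSpace Θ] [MeasurableSpace Ω]
    -- the function class; the suprema inside the Rademacher complexity are random variables
    (F : Set (Y → ℝ)) (hF : ABC.IsIPSClass F)
    (hFmeas : ∀ (n : ℕ) (ε : Fin n → ℤˣ),
      Measurable fun x : Fin n → Y => ABC.rademacherSup F ε x)
    -- the statistical model, the prior and the data generating process
    (model : Kernel Θ Y) [IsMarkovKernel model]
    (prior : Measure Θ) [IsProbabilityMeasure prior]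
    (μstar : Measure Y) [IsProbabilityMeasure μstar]
    -- i.i.d. data
    (P : Measure Ω) [IsProbabilityMeasure P] (y : ℕ → Ω → Y)
    (hy_meas : ∀ i, Measurable (y i)) (hy_indep : iIndepFun y P)
    (hy_law : ∀ i, P.map (y i) = μstar)
    -- prior mass
    (L cπ : ℝ) (hL : 0 < L) (hcπ : 0 < cπ)
    (hprior : ∀ᶠ ε : ℝ in 𝓝[>] 0,
      ENNReal.ofReal (cπ * ε ^ L) ≤
        prior {θ | ABC.ips F (model θ) μstar ≤
          ABC.minDiscrepancy F model μstar + ENNReal.ofReal ε})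
    -- uniform boundedness
    (b : ℝ) (hb : 0 < b) (hFb : ∀ f ∈ F, ∀ x, |f x| ≤ b)
    -- vanishing uniform Rademacher complexity
    (hR : Tendsto (fun n => ABC.uniformRademacher F n) atTop (𝓝 0))
    -- the tolerance sequence
    (εbar : ℕ → ℝ) (hε : Tendsto εbar atTop (𝓝 0))
    (hnε : Tendsto (fun n : ℕ => (n : ℝ) * εbar n ^ 2) atTop atTop)
    (hεR : Tendsto (fun n => ENNReal.ofReal (εbar n) / ABC.uniformRademacher F n) atTop (𝓝 ∞)) :
    ABC.WithProbTendingToOne P fun n =>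
      {ω | let post := ABC.abcPosterior F model prior (fun i : Fin n => y i ω)
              (ABC.minDiscrepancy F model μstar + ENNReal.ofReal (εbar n))
        IsProbabilityMeasure post ∧
        post {θ | ABC.ips F (model θ) μstar >
            ABC.minDiscrepancy F model μstar + ENNReal.ofReal (4 * εbar n / 3)
              + 2 * ABC.uniformRademacher F n
              + ENNReal.ofReal (Real.sqrt (2 * b ^ 2 / n * Real.log (n / εbar n ^ L)))}
          ≤ ENNReal.ofReal (2 * 3 ^ L / (cπ * n))} := by
  have hFm : ∀ f ∈ F, Measurable f := by
    obtain ⟨g, -, -, h⟩ := hF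
    exact fun f hf => (h f hf).1
  -- A ratio above 12 gives twice the complexity at most ε/6, and also forces `εbar n` to be
  -- positive.
  have hratio := hεR.eventually (lt_mem_nhds (ENNReal.ofNat_lt_top (n := 12)))
  have hpos : ∀ᶠ n in atTop, 0 < εbar n := by
    filter_upwards [hratio] with n h
    by_contra h0
    rw [ENNReal.ofReal_of_nonpos (not_lt.1 h0), ENNReal.zero_div] at h
    exact not_lt_bot h
  have hR6 : ∀ᶠ n in atTop, 2 * ABC.uniformRademacher F n ≤ ENNReal.ofReal (εbar n / 6) := by
    filter_upwards [hratio] with n h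
    have h12 : ABC.uniformRademacher F n * 12 ≤ ENNReal.ofReal (εbar n) := by
      rw [mul_comm]
      exact ENNReal.mul_le_of_le_div h.le
    rw [ENNReal.ofReal_div_of_pos (by norm_num), ENNReal.le_div_iff_mul_le (by simp) (by simp)]
    refine le_of_eq_of_le ?_ h12
    rw [ENNReal.ofReal_ofNat, mul_comm 2, mul_assoc]
    norm_num
  have hexp0 : Tendsto (fun n : ℕ => Real.exp (-(n * (εbar n / 6) ^ 2 / (2 * b ^ 2)))) atTop
      (𝓝 0) := by
    refine Real.tendsto_exp_neg_atTop_nhds_zero.comp ?_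
    refine (hnε.const_mul_atTop (show 0 < 1 / (72 * b ^ 2) by positivity)).congr fun n => ?_
    field_simp
    ring
  have hprior3 : ∀ᶠ n in atTop, ENNReal.ofReal (cπ * (εbar n / 3) ^ L) ≤
      prior {θ | ABC.ips F (model θ) μstar ≤
        ABC.minDiscrepancy F model μstar + ENNReal.ofReal (εbar n / 3)} := by
    have h3 : Tendsto (fun n => εbar n / 3) atTop (𝓝[>] 0) := by
      refine tendsto_nhdsWithin_iff.2 ⟨by simpa using hε.div_const 3, ?_⟩
      filter_upwards [hpos] with n h
      exact Set.mem_Ioi.2 (by positivity)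
    exact h3.eventually hprior
  refine tendsto_of_tendsto_of_tendsto_of_le_of_le' tendsto_const_nhds
    (by simpa using ENNReal.tendsto_ofReal hexp0) (Eventually.of_forall fun _ => zero_le) ?_
  filter_upwards [hpos, hR6, hprior3, eventually_ge_atTop 1,
    hexp0.eventually (ge_mem_nhds (by norm_num : (0 : ℝ) < 1 / 2)),
    hε.eventually (ge_mem_nhds one_pos)] with n hpos hR6 hprior3 hn hexp hε1
  have hn0 : n ≠ 0 := by omega
  have hlaw : P.map (fun ω (i : Fin n) => y i ω) = Measure.pi fun _ => μstar := by
    have := (iIndepFun_iff_map_fun_eq_pi_map fun i : Fin n => (hy_meas i).aemeasurable).1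
      (hy_indep.precomp (g := fun i : Fin n => (i : ℕ)) Fin.val_injective)
    simpa only [hy_law] using this
  have hmy : Measurable fun ω (i : Fin n) => y i ω := measurable_pi_iff.2 fun i => hy_meas i
  have htail := ABC.measure_ghostDeviation_gt_le hFm hFmeas hb hFb μstar hn0
    (s := εbar n / 6) (by positivity)
  rw [← hlaw, Measure.map_apply hmy (measurableSet_lt measurable_const
    (ABC.measurable_ghostDeviation hFm hFmeas μstar n))] at htail
  -- The failure event, possibly nonmeasurable, lies in the measurable event where the ghost
  -- deviation of the data is large.
  refine (measure_mono fun ω hω => ?_).trans htail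
  by_contra hgood
  refine hω (ABC.abcPosterior_concentration hFm hFmeas hb hFb model prior hn0 hpos hcπ hR6
    ?_ hexp hprior3 ?_)
  -- Eventually ε ≤ 1 ≤ n, so the logarithm under the square root is nonnegative and no truncation
  -- occurs.
  · have h1 : εbar n ^ L ≤ 1 := Real.rpow_le_one hpos.le hε1 hL.le
    rw [one_le_div (Real.rpow_pos_of_pos hpos L)]
    exact h1.trans (by exact_mod_cast hn)
  · refine (ABC.ips_empirical_le_ghostDeviation hFm hFb μstar hn0 _).trans
      ((not_lt.1 hgood).trans ?_)
    calc _ ≤ ENNReal.ofReal (εbar n / 6) + ENNReal.ofReal (εbar n / 6) := by gcongr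
      _ = _ := by
        rw [← ENNReal.ofReal_add (by positivity) (by positivity)]
        ring_nf
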